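/- Let $\Gamma$ be a (discrete) group. A normed $\Gamma$-module is a real normed vector space with a $\Gamma$-action by linear isometries. If $V$ is a normed $\Gamma$-module, its topological dual $V'$ is a Banach $\Gamma$-module under the contragredient action $(g\cdot\lambda)(v)=\lambda(g^{-1}v)$; modules of this form are called dual. For a normed $\Gamma$-module $E$, the bounded cohomology $H^\bullet_b(\Gamma;E)$ is the cohomology of the complex $(\ell^\infty(\Gamma^{\bullet+1};E)^\Gamma,\delta^\bullet)$ of bounded $\Gamma$-invariant functions (for the diagonal action on $\Gamma^{\bullet+1}$), where $\delta^\bullet$ is the simplicial coboundary operator. The group $\Gamma$ is called $\mathfrak{X}_{\mathrm{sep}}$-boundedly acyclic if $H^k_b(\Gamma;E)=0$ for all integers $k>0$ and all dual Banach $\Gamma$-modules $E$ that are separable in the norm topology. **Lemma.** Let $\Lambda<\Gamma$ be a subgroup of finite index. Then $\Lambda$ is $\mathfrak{X}_{\mathrm{sep}}$-boundedly acyclic if and only if $\Gamma$ is $\mathfrak{X}_{\mathrm{sep}}$-boundedly acyclic. -/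

import Mathlib

universe u v w

noncomputable section

namespace BoundedCohomology

/-- A normed `Γ`-module structure on a real normed space `E` is an action of `Γ` by linear
isometries, recorded as a homomorphism to the group of linear isometric automorphisms of `E`. -/
abbrev IsometricAction (Γ : Type u) [Group Γ] (E : Type v) [NormedAddCommGroup E]
    [NormedSpace ℝ E] : Type (max u v) :=
  Γ →* (E ≃ₗᵢ[ℝ] E)

section Dual

variable {Γ : Type u} [Group Γ] {V : Type w} [NormedAddCommGroup V] [NormedSpace ℝ V]

/-- The contragredient action on the topological dual: `(g • l) v = l (g⁻¹ • v)`. -/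
def contragredient (ρ : IsometricAction Γ V) : IsometricAction Γ (StrongDual ℝ V) where
  toFun g :=
    { toFun := fun l => l.comp ((ρ g⁻¹).toContinuousLinearEquiv : V →L[ℝ] V)
      invFun := fun l => l.comp ((ρ g).toContinuousLinearEquiv : V →L[ℝ] V)
      map_add' := fun _ _ => rfl
      map_smul' := fun _ _ => rfl
      left_inv := fun l => by
        ext v
        simpa only [map_inv] using! congrArg l ((ρ g).symm_apply_apply v)
      right_inv := fun l => by
        ext v
        simpa only [map_inv] using! congrArg l ((ρ g).apply_symm_apply v)
      norm_map' := fun l => l.opNorm_comp_linearIsometryEquiv (ρ g⁻¹) }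
  map_one' := by
    ext l v
    simp
  map_mul' g h := by
    ext l v
    simp

theorem contragredient_apply (ρ : IsometricAction Γ V) (g : Γ) (l : StrongDual ℝ V) (v : V) :
    contragredient ρ g l v = l (ρ g⁻¹ v) :=
  rfl

end Dual

section Complex

variable {Γ : Type u} [Group Γ] {E : Type v} [NormedAddCommGroup E] [NormedSpace ℝ E]

/-- The space `ℓ^∞(Γ^{n+1}; E)^Γ` of bounded functions `f : Γ^{n+1} → E` that are invariant
under `(g • f) x = g • f (g⁻¹ x)`, with `Γ` acting diagonally by left multiplication on
`Γ^{n+1}`; that is, `f (g x) = g • f x`. -/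
def boundedCochains (ρ : IsometricAction Γ E) (n : ℕ) :
    Submodule ℝ ((Fin (n + 1) → Γ) → E) where
  carrier := {f | (∃ C : ℝ, ∀ x, ‖f x‖ ≤ C) ∧
    ∀ (g : Γ) (x : Fin (n + 1) → Γ), f (fun i => g * x i) = ρ g (f x)}
  zero_mem' := ⟨⟨0, fun x => by simp⟩, fun g x => by simp⟩
  add_mem' := by
    rintro a b ⟨⟨C, hC⟩, ha⟩ ⟨⟨D, hD⟩, hb⟩
    refine ⟨⟨C + D, fun x => (norm_add_le _ _).trans (add_le_add (hC x) (hD x))⟩, fun g x => ?_⟩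
    simp [ha, hb]
  smul_mem' := by
    rintro c a ⟨⟨C, hC⟩, ha⟩
    refine ⟨⟨‖c‖ * C, fun x => ?_⟩, fun g x => by simp [ha]⟩
    rw [Pi.smul_apply, norm_smul]
    exact mul_le_mul_of_nonneg_left (hC x) (norm_nonneg c)

instance (ρ : IsometricAction Γ E) (n : ℕ) : AddCommGroup (boundedCochains ρ n) :=
  Submodule.addCommGroup _

/-- The simplicial coboundary operator
`(δ f)(x₀, …, x_{n+1}) = ∑ i, (-1)^i f (x₀, …, x̂ᵢ, …, x_{n+1})` on bounded invariant cochains. -/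
def coboundary (ρ : IsometricAction Γ E) (n : ℕ) :
    boundedCochains ρ n →ₗ[ℝ] boundedCochains ρ (n + 1) where
  toFun f := ⟨fun x => ∑ i : Fin (n + 2), (-1 : ℝ) ^ (i : ℕ) • f.1 (fun j => x (i.succAbove j)), by
    obtain ⟨f, ⟨C, hC⟩, hf⟩ := f
    refine ⟨⟨∑ _i : Fin (n + 2), C, fun x => (norm_sum_le _ _).trans
      (Finset.sum_le_sum fun i _ => ?_)⟩, fun g x => ?_⟩
    · rw [norm_smul]
      simpa using hC _
    · rw [map_sum]
      refine Finset.sum_congr rfl fun i _ => ?_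
      rw [map_smul, ← hf]⟩
  map_add' a b := by
    ext x
    simp [Finset.sum_add_distrib]
  map_smul' c a := by
    ext x
    simp [Finset.smul_sum, smul_comm c]

theorem coboundary_apply (ρ : IsometricAction Γ E) (n : ℕ) (f : boundedCochains ρ n)
    (x : Fin (n + 2) → Γ) :
    (coboundary ρ n f).1 x =
      ∑ i : Fin (n + 2), (-1 : ℝ) ^ (i : ℕ) • f.1 (fun j => x (i.succAbove j)) :=
  rfl

/-- The bounded `n`-cocycles, the kernel of `δ`. -/
def cocycles (ρ : IsometricAction Γ E) (n : ℕ) : Submodule ℝ (boundedCochains ρ n) :=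
  LinearMap.ker (coboundary ρ n)

/-- The bounded `n`-coboundaries, the image of the preceding `δ`, which is zero for `n = 0`. -/
def coboundaries (ρ : IsometricAction Γ E) : (n : ℕ) → Submodule ℝ (boundedCochains ρ n)
  | 0 => ⊥
  | n + 1 => LinearMap.range (coboundary ρ n)

theorem coboundary_coboundary (ρ : IsometricAction Γ E) (n : ℕ) (f : boundedCochains ρ n) :
    coboundary ρ (n + 1) (coboundary ρ n f) = 0 := by
  ext x
  simp only [coboundary_apply, Finset.smul_sum, smul_smul, ← pow_add, ZeroMemClass.coe_zero,
    Pi.zero_apply]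
  rw [← Finset.sum_product']
  refine Finset.sum_involution (fun p _ => (p.1.succAbove p.2, p.2.predAbove p.1))
    ?_ ?_ ?_ ?_
  · rintro ⟨i, j⟩ -
    simp only [Fin.succAbove_succAbove_succAbove_predAbove,
      Fin.neg_one_pow_succAbove_add_predAbove, neg_smul, add_neg_cancel]
  · rintro ⟨i, j⟩ - - h
    exact Fin.succAbove_ne i j (congrArg Prod.fst h)
  · rintro ⟨i, j⟩ -
    simp
  · rintro ⟨i, j⟩ -
    simp only [Fin.succAbove_succAbove_predAbove, Fin.predAbove_predAbove_succAbove]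

theorem coboundaries_le_cocycles (ρ : IsometricAction Γ E) (n : ℕ) :
    coboundaries ρ n ≤ cocycles ρ n := by
  cases n with
  | zero => exact bot_le
  | succ n =>
    rintro _ ⟨f, rfl⟩
    exact coboundary_coboundary ρ n f

/-- The bounded cohomology `H_b^n(Γ; E)`: bounded cocycles modulo bounded coboundaries. -/
abbrev Cohomology (ρ : IsometricAction Γ E) (n : ℕ) : Type (max u v) :=
  cocycles ρ n ⧸ (coboundaries ρ n).submoduleOf (cocycles ρ n)

end Complex

/-- `Γ` is `𝔛_sep`-boundedly acyclic: `H_b^k(Γ; E) = 0` for all `k > 0` and all separable dual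
Banach `Γ`-modules `E`, that is, `E` is the dual of a real normed `Γ`-module `V` (in the universe
`w`) with the contragredient action, and `E` is separable for its norm topology. -/
def XsepBoundedlyAcyclic (Γ : Type u) [Group Γ] : Prop :=
  ∀ (V : Type w) [NormedAddCommGroup V] [NormedSpace ℝ V] (ρ : IsometricAction Γ V),
    TopologicalSpace.SeparableSpace (StrongDual ℝ V) →
      ∀ k : ℕ, 0 < k → Subsingleton (Cohomology (contragredient ρ) k)

end BoundedCohomology

end

/-! Both directions rest on a finite transversal `rep` of Γ/Λ, equal to 1 at the base coset, and on
the Λ-equivariant retraction of Γ onto Λ that it defines.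

From Λ to Γ (transfer): the restriction to Λ of a Γ-cocycle has a primitive. Pulled back along the
retraction and corrected by the prism homotopy (`simplicialDiff_prism`), it becomes a bounded
Λ-equivariant primitive on Γ; averaging over the transversal makes it Γ-equivariant.

From Γ to Λ (Shapiro): a Λ-cocycle with values in V' coinduces to a Γ-cocycle with values in the
dual of the induced module. That module is a finite power of V, so its dual stays separable. A
primitive there, restricted to Λ and to the base coordinate, is a primitive of the original cocycle
(`coinduce_comp_single`). -/

namespace BoundedCohomology

noncomputable section

/-! ### Simplicial coboundary and prism homotopy -/

section Simplicial

variable {X : Type*} {E : Type*} [AddCommGroup E] [Module ℝ E]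

/-- The simplicial coboundary of a function of `n` variables. -/
def simplicialDiff (n : ℕ) (f : (Fin n → X) → E) (x : Fin (n + 1) → X) : E :=
  ∑ i : Fin (n + 1), (-1 : ℝ) ^ (i : ℕ) • f (fun j => x (i.succAbove j))

/-- Splitting off the face that omits x₀ gives a recursion of the same shape as that of `prism`. -/
theorem simplicialDiff_succ (n : ℕ) (f : (Fin (n + 1) → X) → E) (x : Fin (n + 2) → X) :
    simplicialDiff (n + 1) f x =
      f (Fin.tail x) - simplicialDiff n (fun y => f (Fin.cons (x 0) y)) (Fin.tail x) := by
  unfold simplicialDiff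
  rw [Fin.sum_univ_succ, sub_eq_add_neg, ← Finset.sum_neg_distrib]
  congr 1
  · simp [Fin.tail_def]
  · refine Finset.sum_congr rfl fun i _ => ?_
    rw [Fin.val_succ, pow_succ, mul_neg_one, neg_smul]
    congr 3
    funext j
    refine Fin.cases ?_ (fun j => ?_) j
    · simp
    · simp [Fin.tail]

theorem simplicialDiff_fin_zero (f : (Fin 0 → X) → E) (x : Fin 1 → X) (z : Fin 0 → X) :
    simplicialDiff 0 f x = f z := by
  have h : (fun j : Fin 0 => x ((0 : Fin 1).succAbove j)) = z := Subsingleton.elim _ _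
  simp [simplicialDiff, ← h]

theorem simplicialDiff_sub (n : ℕ) (f g : (Fin n → X) → E) (x : Fin (n + 1) → X) :
    simplicialDiff n (fun y => f y - g y) x = simplicialDiff n f x - simplicialDiff n g x := by
  simp [simplicialDiff, smul_sub]

theorem simplicialDiff_sum {ι : Type*} (s : Finset ι) (n : ℕ) (f : ι → (Fin n → X) → E)
    (x : Fin (n + 1) → X) :
    simplicialDiff n (fun y => ∑ q ∈ s, f q y) x = ∑ q ∈ s, simplicialDiff n (f q) x := by
  simp only [simplicialDiff, Finset.smul_sum]
  exact Finset.sum_comm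

theorem simplicialDiff_map {F : Type*} [AddCommGroup F] [Module ℝ F] (A : E →ₗ[ℝ] F) (n : ℕ)
    (f : (Fin n → X) → E) (x : Fin (n + 1) → X) :
    simplicialDiff n (fun y => A (f y)) x = A (simplicialDiff n f x) := by
  simp [simplicialDiff, map_sum]

theorem simplicialDiff_comp {Y : Type*} (r : Y → X) (n : ℕ) (f : (Fin n → X) → E)
    (x : Fin (n + 1) → Y) :
    simplicialDiff n (fun y => f (fun i => r (y i))) x = simplicialDiff n f (fun i => r (x i)) :=
  rfl

/-- The prism operator attached to a self-map `r`:
`(P f)(x₀, …, x_{n-1}) = ∑ i, (-1)^i f (x₀, …, xᵢ, r xᵢ, …, r x_{n-1})`. -/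
def prism (r : X → X) : (n : ℕ) → ((Fin (n + 1) → X) → E) → (Fin n → X) → E
  | 0, _, _ => 0
  | n + 1, f, x =>
    f (Fin.cons (x 0) fun i => r (x i)) - prism r n (fun y => f (Fin.cons (x 0) y)) (Fin.tail x)

omit [Module ℝ E] in
theorem prism_sub (r : X → X) (n : ℕ) (f g : (Fin (n + 1) → X) → E) (x : Fin n → X) :
    prism r n (fun y => f y - g y) x = prism r n f x - prism r n g x := by
  induction n with
  | zero => simp [prism]
  | succ n ih => simp only [prism, ih]; abel

omit [Module ℝ E] in
theorem prism_zero (r : X → X) (n : ℕ) (x : Fin n → X) :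
    prism r n (fun _ => (0 : E)) x = 0 := by
  induction n with
  | zero => rfl
  | succ n ih => simp [prism, ih]

theorem prism_map (r : X → X) (A : E →ₗ[ℝ] E) (n : ℕ) (f : (Fin (n + 1) → X) → E)
    (x : Fin n → X) : prism r n (fun y => A (f y)) x = A (prism r n f x) := by
  induction n with
  | zero => simp [prism]
  | succ n ih => simp [prism, ih]

omit [Module ℝ E] in
theorem prism_comp (r t : X → X) (h : ∀ a, r (t a) = t (r a)) (n : ℕ)
    (f : (Fin (n + 1) → X) → E) (x : Fin n → X) :
    prism r n f (fun i => t (x i)) = prism r n (fun y => f (fun i => t (y i))) x := by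
  induction n with
  | zero => rfl
  | succ n ih =>
    simp only [prism]
    congr 1
    · congr 1
      funext i
      refine Fin.cases ?_ (fun i => ?_) i <;> simp [h]
    · have e : Fin.tail (fun i => t (x i)) = fun i => t (Fin.tail x i) := rfl
      rw [e, ih]
      congr 1
      funext y
      congr 1
      funext i
      refine Fin.cases ?_ (fun i => ?_) i <;> simp

/-- Chain homotopy between pullback along r and the identity. Unfolding both recursions at x₀, the
terms in f(x₀, r x₀, …) cancel, as do the two prisms of f at the tail; what remains is the induction
hypothesis for f(x₀, ·). -/
theorem simplicialDiff_prism (r : X → X) (n : ℕ) (f : (Fin (n + 1) → X) → E)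
    (x : Fin (n + 1) → X) :
    simplicialDiff n (prism r n f) x + prism r (n + 1) (simplicialDiff (n + 1) f) x =
      f (fun i => r (x i)) - f x := by
  induction n with
  | zero =>
    have h0 : simplicialDiff 0 (prism r 0 f) x = 0 := by simp [simplicialDiff, prism]
    rw [h0, zero_add]
    simp only [prism, sub_zero]
    rw [simplicialDiff_succ, Fin.tail_cons, Fin.cons_zero,
      simplicialDiff_fin_zero _ _ (Fin.tail x), Fin.cons_self_tail]
  | succ n ih =>
    have e1 : (fun y => simplicialDiff (n + 2) f (Fin.cons (x 0) y)) =
        fun y => f y - simplicialDiff (n + 1) (fun z => f (Fin.cons (x 0) z)) y := by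
      funext y
      rw [simplicialDiff_succ]
      simp
    have e2 : (fun y => prism r (n + 1) f (Fin.cons (x 0) y)) = fun y =>
        f (Fin.cons (x 0) (Fin.cons (r (x 0)) fun i => r (y i))) -
          prism r n (fun z => f (Fin.cons (x 0) z)) y := by
      funext y
      simp only [prism, Fin.cons_zero, Fin.tail_cons]
      congr 3
      funext i
      refine Fin.cases ?_ (fun i => ?_) i <;> simp
    have e3 : prism r (n + 2) (simplicialDiff (n + 2) f) x =
        simplicialDiff (n + 2) f (Fin.cons (x 0) fun i => r (x i)) -
          prism r (n + 1) (fun y => simplicialDiff (n + 2) f (Fin.cons (x 0) y)) (Fin.tail x) :=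
      rfl
    rw [simplicialDiff_succ n, e2, simplicialDiff_sub, e3, e1, prism_sub,
      simplicialDiff_succ (n + 1)]
    simp only [Fin.tail_cons, Fin.cons_zero]
    rw [simplicialDiff_succ n (fun y => f (Fin.cons (x 0) y))]
    have e4 := ih (fun z => f (Fin.cons (x 0) z)) (Fin.tail x)
    have e5 : (Fin.cons (x 0) (Fin.tail x) : Fin (n + 2) → X) = x := Fin.cons_self_tail x
    rw [e5] at e4
    have e6 : Fin.tail (fun i => r (x i)) = fun i => r (Fin.tail x i) := rfl
    have e7 := simplicialDiff_comp r n
      (fun y => f (Fin.cons (x 0) (Fin.cons (r (x 0)) y))) (Fin.tail x)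
    rw [e7, e6]
    rw [← sub_eq_zero] at e4 ⊢
    rw [← e4]
    abel

end Simplicial

section Prism

variable {X : Type*} {E : Type*} [NormedAddCommGroup E]

theorem norm_prism_le (r : X → X) (n : ℕ) (f : (Fin (n + 1) → X) → E) (C : ℝ)
    (hf : ∀ x, ‖f x‖ ≤ C) (x : Fin n → X) : ‖prism r n f x‖ ≤ n * C := by
  induction n with
  | zero => simp [prism]
  | succ n ih =>
    refine (norm_sub_le _ _).trans ?_
    have h := ih (fun y => f (Fin.cons (x 0) y)) (fun y => hf _) (Fin.tail x)
    have h' := hf (Fin.cons (x 0) fun i => r (x i))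
    push_cast
    linarith

end Prism

theorem subsingleton_cohomology_succ_iff {Γ : Type*} [Group Γ] {E : Type*} [NormedAddCommGroup E]
    [NormedSpace ℝ E] (ρ : IsometricAction Γ E) (k : ℕ) :
    Subsingleton (Cohomology ρ (k + 1)) ↔
      ∀ f ∈ boundedCochains ρ (k + 1), (∀ x, simplicialDiff (k + 2) f x = 0) →
        ∃ b ∈ boundedCochains ρ k, ∀ x, simplicialDiff (k + 1) b x = f x := by
  rw [Submodule.Quotient.subsingleton_iff, Submodule.submoduleOf_eq_top]
  constructor
  · intro h f hf hd
    have hc : (⟨f, hf⟩ : boundedCochains ρ (k + 1)) ∈ cocycles ρ (k + 1) :=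
      LinearMap.mem_ker.2 (Subtype.ext (funext hd))
    obtain ⟨b, hb⟩ := h hc
    exact ⟨b.1, b.2, fun x => congrFun (congrArg Subtype.val hb) x⟩
  · rintro h ⟨f, hf⟩ hc
    obtain ⟨b, hb, hd⟩ := h f hf
      fun x => congrFun (congrArg Subtype.val (LinearMap.mem_ker.1 hc)) x
    exact ⟨⟨b, hb⟩, Subtype.ext (funext hd)⟩

/-! ### Transversals and the retraction onto Λ -/

/-- A transversal `s` of an action of `Γ` on `ι` for which `Λ` fixes the base point, with
`s = 1` there, and for which the transition elements `s(q)⁻¹ g s(g⁻¹ q)` lie in `Λ`. -/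
structure Transversal {Γ : Type*} [Group Γ] (Λ : Subgroup Γ) (ι : Type*) [MulAction Γ ι] where
  /-- The representatives. -/
  rep : ι → Γ
  /-- The base point. -/
  base : ι
  rep_base : rep base = 1
  smul_base : ∀ l ∈ Λ, l • base = base
  mem : ∀ g q, (rep q)⁻¹ * g * rep (g⁻¹ • q) ∈ Λ

namespace Transversal

variable {Γ : Type*} [Group Γ] {Λ : Subgroup Γ} {ι : Type*} [MulAction Γ ι]

/-- The transversal of `Γ ⧸ Λ`, transported along a bijection. -/
def ofEquiv (Λ : Subgroup Γ) {ι : Type*} (e : ι ≃ Γ ⧸ Λ) :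
    letI := e.mulAction Γ
    Transversal Λ ι :=
  letI := e.mulAction Γ
  -- The chosen representative of the trivial coset lies in Λ but need not be 1; dividing by it on
  -- the right normalises the base and keeps transitions in Λ.
  { rep := fun q => (e q).out * ((1 : Γ) : Γ ⧸ Λ).out⁻¹
    base := e.symm ((1 : Γ) : Γ ⧸ Λ)
    rep_base := by simp
    smul_base := fun l hl => by
      rw [Equiv.smul_def, e.apply_symm_apply]
      congr 1
      change ((l * 1 : Γ) : Γ ⧸ Λ) = _
      rw [QuotientGroup.eq]
      simpa using hl
    mem := fun g q => by
      rw [Equiv.smul_def, e.apply_symm_apply]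
      have h1 : ((1 : Γ) : Γ ⧸ Λ).out ∈ Λ := by
        have h : ((((1 : Γ) : Γ ⧸ Λ).out : Γ) : Γ ⧸ Λ) = ((1 : Γ) : Γ ⧸ Λ) := Quotient.out_eq _
        rw [QuotientGroup.eq] at h
        simpa using h
      have h2 : (e q).out⁻¹ * (g * (g⁻¹ • e q).out) ∈ Λ := by
        rw [← QuotientGroup.eq]
        have h3 : ((g * (g⁻¹ • e q).out : Γ) : Γ ⧸ Λ) = g • (((g⁻¹ • e q).out : Γ) : Γ ⧸ Λ) := rfl
        rw [h3, QuotientGroup.out_eq', QuotientGroup.out_eq', smul_inv_smul]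
      have h3 := Λ.mul_mem (Λ.mul_mem h1 h2) (Λ.inv_mem h1)
      simpa [mul_assoc] using h3 }

variable (T : Transversal Λ ι)

/-- The transition element `s(q)⁻¹ g s(g⁻¹ q)` of `Λ`. -/
def transition (g : Γ) (q : ι) : Λ := ⟨(T.rep q)⁻¹ * g * T.rep (g⁻¹ • q), T.mem g q⟩

theorem rep_inv_mul (g : Γ) (q : ι) :
    (T.rep q)⁻¹ * g = T.transition g q * (T.rep (g⁻¹ • q))⁻¹ := by
  simp [transition]

theorem transition_one (q : ι) : T.transition 1 q = 1 := by
  ext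
  simp [transition]

/-- The cocycle identity that makes `inducedMap` an action. -/
theorem transition_mul (g h : Γ) (q : ι) :
    T.transition (g * h) q = T.transition g q * T.transition h (g⁻¹ • q) := by
  ext
  simp [transition, mul_assoc, mul_smul]

theorem transition_inv (g : Γ) (q : ι) :
    T.transition g⁻¹ (g⁻¹ • q) = (T.transition g q)⁻¹ := by
  ext
  simp [transition, mul_assoc]

theorem transition_base (l : Λ) : T.transition l T.base = l := by
  ext
  simp [transition, T.rep_base, T.smul_base _ (Λ.inv_mem l.2)]

/-- The `Λ`-equivariant retraction of `Γ` onto `Λ`. -/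
def retraction (g : Γ) : Λ := T.transition g T.base

theorem retraction_mul (l : Λ) (g : Γ) : T.retraction (l * g) = l * T.retraction g := by
  rw [retraction, transition_mul, transition_base, T.smul_base _ (Λ.inv_mem l.2), retraction]

theorem retraction_coe (l : Λ) : T.retraction l = l := T.transition_base l

/-! ### Transfer: from Λ to Γ -/

section Average

variable [Fintype ι] {E : Type*} [NormedAddCommGroup E] [NormedSpace ℝ E]

/-- The average over the transversal of the translates of a `Λ`-equivariant function. -/
def average (ρ : IsometricAction Γ E) {n : ℕ} (c : (Fin n → Γ) → E) (x : Fin n → Γ) : E :=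
  (Fintype.card ι : ℝ)⁻¹ • ∑ q, ρ (T.rep q) (c fun i => (T.rep q)⁻¹ * x i)

omit [Fintype ι] in
theorem rep_mul_transition (g : Γ) (q : ι) :
    T.rep q * T.transition g q = g * T.rep (g⁻¹ • q) := by
  simp [transition, mul_assoc]

/-- Translation by g permutes the summands: Λ-equivariance absorbs the transition element, and the
term at q becomes ρ g of the term at g⁻¹q. -/
theorem average_mul (ρ : IsometricAction Γ E) {n : ℕ} (c : (Fin n → Γ) → E)
    (hc : ∀ (l : Λ) x, c (fun i => l * x i) = ρ l (c x)) (g : Γ) (x : Fin n → Γ) :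
    T.average ρ c (fun i => g * x i) = ρ g (T.average ρ c x) := by
  unfold average
  rw [map_smul, map_sum,
    ← Equiv.sum_comp (MulAction.toPerm g⁻¹ : Equiv.Perm ι) fun q =>
      ρ g (ρ (T.rep q) (c fun i => (T.rep q)⁻¹ * x i))]
  congr 1
  refine Finset.sum_congr rfl fun q _ => ?_
  have h : (fun i => (T.rep q)⁻¹ * (g * x i)) =
      fun i => (T.transition g q : Γ) * ((T.rep (g⁻¹ • q))⁻¹ * x i) := funext fun i => by
    rw [← mul_assoc, rep_inv_mul, mul_assoc]
  have hm (a b : Γ) (e : E) : ρ a (ρ b e) = ρ (a * b) e := by rw [map_mul]; rfl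
  rw [h, hc, hm, rep_mul_transition, ← hm]
  rfl

theorem norm_average_le (ρ : IsometricAction Γ E) {n : ℕ} (c : (Fin n → Γ) → E) (C : ℝ)
    (hc : ∀ x, ‖c x‖ ≤ C) (x : Fin n → Γ) :
    ‖T.average ρ c x‖ ≤ ‖(Fintype.card ι : ℝ)⁻¹‖ * ∑ _q : ι, C := by
  rw [average, norm_smul]
  gcongr
  refine (norm_sum_le _ _).trans (Finset.sum_le_sum fun q _ => ?_)
  rw [LinearIsometryEquiv.norm_map]
  exact hc _

/-- As f is Γ-equivariant, every translate of c is again a primitive of f, hence so is their mean.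
-/
theorem simplicialDiff_average (ρ : IsometricAction Γ E) {n : ℕ} (c : (Fin n → Γ) → E)
    (f : (Fin (n + 1) → Γ) → E) (hf : ∀ (g : Γ) x, f (fun i => g * x i) = ρ g (f x))
    (hc : ∀ x, simplicialDiff n c x = f x) (x : Fin (n + 1) → Γ) :
    simplicialDiff n (T.average ρ c) x = f x := by
  have h := simplicialDiff_map ((Fintype.card ι : ℝ)⁻¹ • (LinearMap.id : E →ₗ[ℝ] E)) n
    (fun x => ∑ q, ρ (T.rep q) (c fun i => (T.rep q)⁻¹ * x i)) x
  refine h.trans ?_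
  rw [simplicialDiff_sum]
  have hq : ∀ q ∈ Finset.univ, simplicialDiff n
      (fun x => ρ (T.rep q) (c fun i => (T.rep q)⁻¹ * x i)) x = f x := fun q _ => by
    refine (simplicialDiff_map ((ρ (T.rep q)).toLinearEquiv : E →ₗ[ℝ] E) n _ x).trans ?_
    rw [simplicialDiff_comp (fun a => (T.rep q)⁻¹ * a), hc, hf]
    simp
  rw [Finset.sum_congr rfl hq]
  have : Nonempty ι := ⟨T.base⟩
  have h0 : (Fintype.card ι : ℝ) ≠ 0 := by simp
  simp [← Nat.cast_smul_eq_nsmul ℝ, smul_smul, h0]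

/-- Vanishing of bounded cohomology passes from a finite index subgroup to the group. -/
theorem subsingleton_cohomology_of_restrict (T : Transversal Λ ι) (ρ : IsometricAction Γ E) (k : ℕ)
    (h : Subsingleton (Cohomology (ρ.comp Λ.subtype) (k + 1))) :
    Subsingleton (Cohomology ρ (k + 1)) := by
  rw [subsingleton_cohomology_succ_iff] at h ⊢
  rintro f ⟨⟨C, hC⟩, hf⟩ hd
  obtain ⟨b, ⟨⟨D, hD⟩, hb⟩, hbf⟩ := h (fun x => f fun i => x i)
    ⟨⟨C, fun x => hC _⟩, fun g x => hf g _⟩ fun x => hd fun i => x i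
  let r : Γ → Γ := fun g => T.retraction g
  -- The pullback of b has coboundary f ∘ r, and the prism of the cocycle f has coboundary f ∘ r -
  -- f.
  let c : (Fin (k + 1) → Γ) → E := fun x => b (fun i => T.retraction (x i)) - prism r (k + 1) f x
  have hcd : ∀ x, simplicialDiff (k + 1) c x = f x := fun x => by
    have h1 := simplicialDiff_prism r (k + 1) f x
    have h2 : simplicialDiff (k + 2) f = fun _ => 0 := funext hd
    rw [h2, prism_zero, add_zero] at h1
    rw [simplicialDiff_sub, h1, simplicialDiff_comp, hbf]
    simp [r]
  have hcl : ∀ (l : Λ) x, c (fun i => l * x i) = ρ l (c x) := fun l x => by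
    have h1 := prism_comp r (fun a => (l : Γ) * a) (fun a => by simp [r, retraction_mul])
      (k + 1) f x
    have h2 := prism_map r ((ρ l).toLinearEquiv : E →ₗ[ℝ] E) (k + 1) f x
    have h3 : (fun y : Fin (k + 2) → Γ => f fun i => l * y i) =
        fun y => ((ρ l).toLinearEquiv : E →ₗ[ℝ] E) (f y) := funext fun y => hf l y
    have h4 := hb l fun i => T.retraction (x i)
    rw [h3, h2] at h1
    simp only [c, retraction_mul, h1, h4, map_sub]
    rfl
  refine ⟨T.average ρ c, ⟨⟨_, T.norm_average_le ρ c (D + (k + 1 : ℕ) * C) fun x => ?_⟩,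
    T.average_mul ρ c hcl⟩, T.simplicialDiff_average ρ c f hf hcd⟩
  exact (norm_sub_le _ _).trans (add_le_add (hD _) (norm_prism_le r _ f C hC x))

end Average

/-! ### Induced modules and the Shapiro argument: from Γ to Λ -/

section Induced

variable [Fintype ι] {V : Type*} [NormedAddCommGroup V] [NormedSpace ℝ V]

/-- The linear map underlying the action of `g` on the module induced from `Λ`. -/
def inducedMap (ρ : IsometricAction Λ V) (g : Γ) : (ι → V) →ₗ[ℝ] (ι → V) where
  toFun v q := ρ (T.transition g q) (v (g⁻¹ • q))
  map_add' v w := by ext; simp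
  map_smul' c v := by ext; simp

omit [Fintype ι] in
theorem inducedMap_mul (ρ : IsometricAction Λ V) (g h : Γ) (v : ι → V) :
    T.inducedMap ρ (g * h) v = T.inducedMap ρ g (T.inducedMap ρ h v) := by
  ext q
  simp [inducedMap, transition_mul, mul_smul]

omit [Fintype ι] in
theorem inducedMap_one (ρ : IsometricAction Λ V) (v : ι → V) : T.inducedMap ρ 1 v = v := by
  ext q
  simp [inducedMap, transition_one]

theorem norm_inducedMap_le (ρ : IsometricAction Λ V) (g : Γ) (v : ι → V) :
    ‖T.inducedMap ρ g v‖ ≤ ‖v‖ := by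
  refine (pi_norm_le_iff_of_nonneg (norm_nonneg v)).2 fun q => ?_
  simpa [inducedMap] using norm_le_pi_norm v (g⁻¹ • q)

/-- The isometric `Γ`-module induced from an isometric `Λ`-module, in coordinates given by the
transversal. -/
def induced (ρ : IsometricAction Λ V) : IsometricAction Γ (ι → V) where
  toFun g :=
    { T.inducedMap ρ g with
      invFun := T.inducedMap ρ g⁻¹
      left_inv := fun v => by
        change T.inducedMap ρ g⁻¹ (T.inducedMap ρ g v) = v
        rw [← inducedMap_mul, inv_mul_cancel, inducedMap_one]
      right_inv := fun v => by
        change T.inducedMap ρ g (T.inducedMap ρ g⁻¹ v) = v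
        rw [← inducedMap_mul, mul_inv_cancel, inducedMap_one]
      norm_map' := fun v => by
        refine le_antisymm (T.norm_inducedMap_le ρ g v) ?_
        have h := T.norm_inducedMap_le ρ g⁻¹ (T.inducedMap ρ g v)
        rwa [← inducedMap_mul, inv_mul_cancel, inducedMap_one] at h }
  map_one' := LinearIsometryEquiv.ext fun v => T.inducedMap_one ρ v
  map_mul' g h := LinearIsometryEquiv.ext fun v => T.inducedMap_mul ρ g h v

theorem induced_apply (ρ : IsometricAction Λ V) (g : Γ) (v : ι → V) (q : ι) :
    T.induced ρ g v q = ρ (T.transition g q) (v (g⁻¹ • q)) :=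
  rfl

/-- Λ fixes the base point with transition l itself, so V embeds Λ-equivariantly as the base
coordinate. -/
theorem induced_single [DecidableEq ι] (ρ : IsometricAction Λ V) (l : Λ) (v : V) :
    T.induced ρ l (Pi.single T.base v) = Pi.single T.base (ρ l v) := by
  ext q
  rw [induced_apply]
  by_cases hq : q = T.base
  · subst hq
    rw [transition_base, T.smul_base _ (Λ.inv_mem l.2)]
    simp
  · have h : (l : Γ)⁻¹ • q ≠ T.base := fun h => hq <| by
      rw [inv_smul_eq_iff, T.smul_base _ l.2] at h
      exact h
    simp [Pi.single_eq_of_ne, hq, h]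

/-- The functional on `ι → V` with the given coordinates. -/
def sumDual (l : ι → StrongDual ℝ V) : StrongDual ℝ (ι → V) :=
  ∑ q, (l q).comp (ContinuousLinearMap.proj q)

omit [MulAction Γ ι] in
theorem sumDual_apply (l : ι → StrongDual ℝ V) (v : ι → V) : sumDual l v = ∑ q, l q (v q) := by
  simp [sumDual]

theorem continuous_sumDual :
    Continuous (sumDual : (ι → StrongDual ℝ V) → StrongDual ℝ (ι → V)) := by
  unfold sumDual
  fun_prop

theorem surjective_sumDual :
    Function.Surjective (sumDual : (ι → StrongDual ℝ V) → StrongDual ℝ (ι → V)) := by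
  classical
  intro L
  refine ⟨fun q => L.comp (ContinuousLinearMap.single ℝ (fun _ => V) q), ?_⟩
  ext v
  rw [sumDual_apply]
  simp only [ContinuousLinearMap.comp_apply, ContinuousLinearMap.single_apply]
  rw [← map_sum, Finset.univ_sum_single]

theorem norm_sumDual_le (l : ι → StrongDual ℝ V) (C : ℝ) (hl : ∀ q, ‖l q‖ ≤ C) :
    ‖sumDual l‖ ≤ ∑ _q : ι, C := by
  refine (norm_sum_le _ _).trans (Finset.sum_le_sum fun q _ => ?_)
  have hC : 0 ≤ C := (norm_nonneg _).trans (hl q)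
  refine ContinuousLinearMap.opNorm_le_bound _ hC fun v => ?_
  exact (l q).le_of_opNorm_le_of_le (hl q) (norm_le_pi_norm v q)

theorem separableSpace_dual_pi [TopologicalSpace.SeparableSpace (StrongDual ℝ V)] :
    TopologicalSpace.SeparableSpace (StrongDual ℝ (ι → V)) :=
  surjective_sumDual.denseRange.separableSpace continuous_sumDual

/-- The function with values in the dual of the induced module that corresponds to a function on
`Λ` with values in the dual. -/
def coinduce {n : ℕ} (f : (Fin n → Λ) → StrongDual ℝ V) (x : Fin n → Γ) : StrongDual ℝ (ι → V) :=
  sumDual fun q => f fun i => T.retraction ((T.rep q)⁻¹ * x i)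

theorem coinduce_mul (ρ : IsometricAction Λ V) {n : ℕ} (f : (Fin n → Λ) → StrongDual ℝ V)
    (hf : ∀ (l : Λ) x, f (fun i => l * x i) = contragredient ρ l (f x)) (g : Γ)
    (x : Fin n → Γ) :
    T.coinduce f (fun i => g * x i) = contragredient (T.induced ρ) g (T.coinduce f x) := by
  ext v
  rw [contragredient_apply, coinduce, coinduce, sumDual_apply, sumDual_apply,
    ← Equiv.sum_comp (MulAction.toPerm g⁻¹ : Equiv.Perm ι) fun q =>
      (f fun i => T.retraction ((T.rep q)⁻¹ * x i)) _]
  refine Finset.sum_congr rfl fun q _ => ?_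
  have h : (fun i => T.retraction ((T.rep q)⁻¹ * (g * x i))) =
      fun i => T.transition g q * T.retraction ((T.rep (g⁻¹ • q))⁻¹ * x i) := funext fun i => by
    rw [← mul_assoc, rep_inv_mul, mul_assoc, retraction_mul]
  rw [h, hf, contragredient_apply, MulAction.toPerm_apply, induced_apply, transition_inv,
    inv_inv, smul_inv_smul]

theorem simplicialDiff_coinduce {n : ℕ} (f : (Fin n → Λ) → StrongDual ℝ V)
    (x : Fin (n + 1) → Γ) :
    simplicialDiff n (T.coinduce f) x = T.coinduce (simplicialDiff n f) x := by
  ext v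
  simp only [simplicialDiff, coinduce, sumDual_apply, sum_apply, smul_apply, Finset.smul_sum]
  exact Finset.sum_comm

/-- At the base, `rep` is 1 and the retraction is the identity on Λ, so this undoes coinduction. -/
theorem coinduce_comp_single [DecidableEq ι] {n : ℕ} (f : (Fin n → Λ) → StrongDual ℝ V)
    (x : Fin n → Λ) :
    (T.coinduce f fun i => x i).comp (ContinuousLinearMap.single ℝ (fun _ => V) T.base) = f x := by
  ext v
  rw [ContinuousLinearMap.comp_apply, coinduce, sumDual_apply,
    Finset.sum_eq_single T.base (fun q _ hq => by simp [hq]) (by simp)]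
  simp [T.rep_base, retraction_coe]

/-- Vanishing of bounded cohomology with coefficients in the dual of the induced module implies
vanishing for the subgroup. -/
theorem subsingleton_cohomology_of_induced (ρ : IsometricAction Λ V) (k : ℕ)
    (h : Subsingleton (Cohomology (contragredient (T.induced ρ)) (k + 1))) :
    Subsingleton (Cohomology (contragredient ρ) (k + 1)) := by
  classical
  rw [subsingleton_cohomology_succ_iff] at h ⊢
  rintro f ⟨⟨C, hC⟩, hf⟩ hd
  obtain ⟨b, ⟨⟨D, hD⟩, hb⟩, hbf⟩ := h (T.coinduce f)
    ⟨⟨_, fun x => norm_sumDual_le _ C fun q => hC _⟩, T.coinduce_mul ρ f hf⟩ fun x => by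
      rw [simplicialDiff_coinduce, funext hd]
      ext v
      simp [coinduce, sumDual_apply]
  let ε : StrongDual ℝ (ι → V) →L[ℝ] StrongDual ℝ V :=
    (ContinuousLinearMap.single ℝ (fun _ => V) T.base).precomp ℝ
  refine ⟨fun x => ε (b fun i => x i),
    ⟨⟨‖ε‖ * D, fun x => ε.le_opNorm_of_le (hD _)⟩, fun l x => ?_⟩, fun x => ?_⟩
  · have h1 := hb l fun i => x i
    ext v
    have h2 : ε (b fun i => ((l * x i : Λ) : Γ)) v =
      b (fun i => (l : Γ) * x i) (Pi.single T.base v) := rfl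
    have h3 : ((l : Γ)⁻¹) = ((l⁻¹ : Λ) : Γ) := rfl
    rw [h2, h1, contragredient_apply, contragredient_apply, h3, induced_single]
    rfl
  · have h1 := simplicialDiff_map (ε : StrongDual ℝ (ι → V) →ₗ[ℝ] StrongDual ℝ V) (k + 1)
      (fun x : Fin (k + 1) → Λ => b fun i => x i) x
    refine h1.trans ?_
    rw [simplicialDiff_comp, hbf]
    exact T.coinduce_comp_single f x

end Induced

end Transversal

end

end BoundedCohomology

theorem mainTheorem11 (Γ : Type u) [Group Γ] (Λ : Subgroup Γ) (hΛ : Λ.FiniteIndex) :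
    BoundedCohomology.XsepBoundedlyAcyclic.{u, w} Λ ↔
      BoundedCohomology.XsepBoundedlyAcyclic.{u, w} Γ := by
  have hfin : Finite (Γ ⧸ Λ) := inferInstance
  -- Indexing by `Fin n` rather than by cosets keeps the induced module in the universe `w` of V.
  obtain ⟨n, ⟨e⟩⟩ := Finite.exists_equiv_fin (Γ ⧸ Λ)
  let _ := e.symm.mulAction Γ
  let T : BoundedCohomology.Transversal Λ (Fin n) :=
    BoundedCohomology.Transversal.ofEquiv Λ e.symm
  constructor
  · intro h V _ _ ρ hV k hk
    obtain ⟨k, rfl⟩ := Nat.exists_eq_succ_of_ne_zero hk.ne'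
    refine BoundedCohomology.Transversal.subsingleton_cohomology_of_restrict T _ k ?_
    -- Contragredient and restriction to Λ commute definitionally.
    exact h V (ρ.comp Λ.subtype) hV (k + 1) hk
  · intro h V _ _ ρ hV k hk
    obtain ⟨k, rfl⟩ := Nat.exists_eq_succ_of_ne_zero hk.ne'
    exact T.subsingleton_cohomology_of_induced ρ k <|
      h (Fin n → V) (T.induced ρ) BoundedCohomology.Transversal.separableSpace_dual_pi (k + 1) hk
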